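/- Let $\omega>0$ and $A>0$. For $u\ge 0$ and $\alpha\in(0,\pi/2)$ consider three Kuramoto–Sakaguchi oscillators coupled by a star network with central node $0$ and peripheral nodes $1,2$, $$\dot\theta_i=\omega+A\sin(\theta_0-\theta_i-\alpha),\quad i=1,2,\qquad \dot\theta_0=\omega+\sum_{j=1}^{2}A\sin(\theta_j-\theta_0-\alpha)+u,$$ with state $\theta=(\theta_0,\theta_1,\theta_2)\in(\mathbb{S}^1)^3$, where $\mathbb{S}^1=\mathbb{R}/2\pi\mathbb{Z}$ and $(\mathbb{S}^1)^3$ carries the Euclidean product of the arc-length distances. Let $\mathcal M=\{\theta\in(\mathbb{S}^1)^3:\theta_1=\theta_2\}$ be the remote synchronization manifold and $\operatorname{dist}(\theta,\mathcal M)=\inf_{y\in\mathcal M}\|\theta-y\|$. The manifold $\mathcal M$ is called exponentially stable along the system if there are $\delta,k,\lambda>0$ such that every solution $\theta:[0,\infty)\to(\mathbb{S}^1)^3$ with $\operatorname{dist}(\theta(0),\mathcal M)<\delta$ satisfies $$\operatorname{dist}(\theta(t),\mathcal M)\le k\,\operatorname{dist}(\theta(0),\mathcal M)\,e^{-\lambda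 t}\qquad\text{for all } t\ge 0.$$ Then there is a constant $\rho>3A$, not depending on $\alpha$, such that for every $u>\rho$ the remote synchronization manifold $\mathcal M$ is exponentially stable for the system for every phase shift $\alpha\in(0,\pi/2)$. (The constants $\delta,k,\lambda$ may depend on $u$ and $\alpha$.) -/

import Mathlib

noncomputable section

namespace RemoteSync

/-- Phase configurations `(θ₀, θ₁, θ₂)` of three oscillators: the product of three circles
`ℝ / 2πℤ`, with the Euclidean (`ℓ²`) combination of the arc-length distances.
Index `0` is the central node, indices `1` and `2` are the peripheral nodes. -/
abbrev Phases : Type := PiLp 2 (fun _ : Fin 3 => Real.Angle)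

/-- The Kuramoto-Sakaguchi velocity field on the star network with two peripheral nodes:
natural frequency `ω`, equal couplings `A`, detuning `u` of the central node, phase shift `α`. -/
def starField (ω A u α : ℝ) (θ : Phases) : Fin 3 → ℝ :=
  ![ω + (A * Real.Angle.sin (θ 1 - θ 0 - (α : Real.Angle))
      + A * Real.Angle.sin (θ 2 - θ 0 - (α : Real.Angle))) + u,
    ω + A * Real.Angle.sin (θ 0 - θ 1 - (α : Real.Angle)),
    ω + A * Real.Angle.sin (θ 0 - θ 2 - (α : Real.Angle))]

/-- `θ` is a solution on `[0, ∞)` of `θ' = F θ`. The derivative of a curve on the circle `ℝ / 2πℤ`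
is the derivative of its real-valued lift; at time `0` it is one-sided. -/
def IsSolution (F : Phases → Fin 3 → ℝ) (θ : ℝ → Phases) : Prop :=
  ∃ x : Fin 3 → ℝ → ℝ, ∀ i : Fin 3, ∀ t : ℝ, 0 ≤ t →
    θ t i = (x i t : Real.Angle) ∧ HasDerivWithinAt (x i) (F (θ t) i) (Set.Ici 0) t

/-- The remote synchronization manifold `θ₁ = θ₂`. -/
def syncManifold : Set Phases := {θ | θ 1 = θ 2}

/-- Exponential stability of a set `S` along `θ' = F θ`: solutions that start at distance less
than `δ` from `S` satisfy `dist(θ(t), S) ≤ k dist(θ(0), S) exp(-λ t)` for all `t ≥ 0`, with constants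
that do not depend on the solution. -/
def IsExpStable (F : Phases → Fin 3 → ℝ) (S : Set Phases) : Prop :=
  ∃ δ > (0 : ℝ), ∃ k > (0 : ℝ), ∃ lam > (0 : ℝ),
    ∀ θ : ℝ → Phases, IsSolution F θ → Metric.infDist (θ 0) S < δ →
      ∀ t : ℝ, 0 ≤ t →
        Metric.infDist (θ t) S ≤ k * Metric.infDist (θ 0) S * Real.exp (-lam * t)

end RemoteSync

end

namespace RemoteSync

open Real

/-! With `φ = θ₀ - θ₁` and `e = θ₁ - θ₂`, the linearized transversal equation is `e' = -A cos(φ - α)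
e`, and for `u > 3A` the phase `φ` rotates forever. Write `f = drift α`, `g = f'`, so that `cos(φ -
α) = a g + b f` with `b > 0`. Along `φ' = u - A f` the term `a g` is a total derivative, while `f`
has positive time average because the rotation is slower where `f > 0`. So the mean transversal rate
is negative. `exists_corrector` turns this into a uniform rate by a periodic `W`; `exists_decay`
uses the Lyapunov function `(1 - cos e) exp(2 W(φ) + μ t)`. -/

/-- The part of the rotation speed of the central node relative to the synchronized peripheral
nodes that depends on the phase difference `φ`: the speed is `u - A * drift α φ`. -/
noncomputable def drift (α φ : ℝ) : ℝ := 2 * sin (φ + α) + sin (φ - α)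

theorem drift_eq (α φ : ℝ) : drift α φ = 3 * cos α * sin φ + sin α * cos φ := by
  rw [drift, sin_add, sin_sub]; ring

theorem abs_drift_le (α φ : ℝ) : |drift α φ| ≤ 3 := by
  have h1 := abs_le.1 (abs_sin_le_one (φ + α))
  have h2 := abs_le.1 (abs_sin_le_one (φ - α))
  rw [abs_le, drift]
  constructor <;> linarith

theorem speed_bounds {A : ℝ} (hA : 0 < A) (u α φ : ℝ) :
    u - 3 * A ≤ u - A * drift α φ ∧ u - A * drift α φ ≤ u + 3 * A := by
  have h := abs_le.1 (abs_drift_le α φ)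
  constructor <;> nlinarith

theorem exists_abs_le_of_continuous_of_periodic {f : ℝ → ℝ} (hf : Continuous f) {c : ℝ}
    (hc : 0 < c) (hp : Function.Periodic f c) : ∃ C, ∀ x, |f x| ≤ C := by
  obtain ⟨C, hC⟩ := (isCompact_Icc (a := (0 : ℝ)) (b := c)).exists_bound_of_continuousOn
    hf.continuousOn
  refine ⟨C, fun x => ?_⟩
  obtain ⟨y, hy, hxy⟩ := hp.exists_mem_Ico₀ hc x
  rw [hxy]
  exact hC y ⟨hy.1, hy.2.le⟩

/-- A periodic corrector that makes the transversal contraction rate `-A cos (φ - α)`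
uniformly negative along the synchronized flow `φ' = u - A * drift α φ`. -/
theorem exists_corrector {A u α : ℝ} (hA : 0 < A) (hu : 3 * A < u) (hα : α ∈ Set.Ioo 0 (π / 2)) :
    ∃ W W' : ℝ → ℝ, ∃ w C μ : ℝ, 0 < μ ∧ 0 ≤ C ∧ (∀ φ, HasDerivAt W (W' φ) φ) ∧
      (∀ φ, |W φ| ≤ w) ∧ (∀ φ, |W' φ| ≤ C) ∧
      ∀ φ, -A * cos (φ - α) + W' φ * (u - A * drift α φ) ≤ -μ := by
  have hs : 0 < sin α := sin_pos_of_pos_of_lt_pi hα.1 (by linarith [hα.2, pi_pos])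
  have hc : 0 < cos α := cos_pos_of_mem_Ioo ⟨by linarith [hα.1, pi_pos], hα.2⟩
  set s := sin α with hs'
  set c := cos α with hc'
  let R := 9 * c ^ 2 + s ^ 2
  have hR : 0 < R := by positivity
  -- Coordinates of `cos(φ - α)` in the basis `g`, `f`; `b > 0` needs both `sin α > 0` and `cos α >
  -- 0`.
  let a := (3 * c ^ 2 - s ^ 2) / R
  let b := 4 * s * c / R
  have hb : 0 < b := by positivity
  have hu0 : 0 < u := by linarith
  -- Chosen so that the error `2κf²(u - A f)` is absorbed by the gain `(A²/u)f²`.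
  let κ := A ^ 2 / (2 * u * (u + 3 * A))
  have hκ : 0 < κ := by positivity
  have hκ' : 2 * κ * (u + 3 * A) = A ^ 2 / u := by
    simp only [κ]; field_simp
  let f : ℝ → ℝ := fun φ => 3 * c * sin φ + s * cos φ
  let g : ℝ → ℝ := fun φ => 3 * c * cos φ - s * sin φ
  have hfd : ∀ φ, drift α φ = f φ := fun φ => drift_eq α φ
  have hpos : ∀ φ, 0 < u - A * f φ := fun φ => by
    have := (speed_bounds hA u α φ).1
    rw [hfd] at this
    linarith
  have hf : ∀ φ, HasDerivAt f (g φ) φ := fun φ => by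
    have := ((hasDerivAt_sin φ).const_mul (3 * c)).add ((hasDerivAt_cos φ).const_mul s)
    refine this.congr_deriv ?_
    simp only [g]; ring
  have hg : ∀ φ, HasDerivAt g (-f φ) φ := fun φ => by
    have := ((hasDerivAt_cos φ).const_mul (3 * c)).sub ((hasDerivAt_sin φ).const_mul s)
    refine this.congr_deriv ?_
    simp only [f]; ring
  have hfg : ∀ φ, g φ ^ 2 + f φ ^ 2 = R := fun φ => by
    simp only [f, g, R]
    linear_combination (9 * c ^ 2 + s ^ 2) * sin_sq_add_cos_sq φ
  have hcos : ∀ φ, cos (φ - α) = a * g φ + b * f φ := fun φ => by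
    rw [cos_sub, ← hs', ← hc']
    simp only [a, b, f, g]
    field_simp
    simp only [R]
    ring
  have hcf : Continuous f := continuous_iff_continuousAt.2 fun φ => (hf φ).continuousAt
  have hcg : Continuous g := continuous_iff_continuousAt.2 fun φ => (hg φ).continuousAt
  -- The logarithm cancels `a g`; `-(A/u)g` replaces `-A f` by `-(A²/u)f²`; the `f g` term restores
  -- strict negativity at the zeros of `f`.
  let W : ℝ → ℝ := fun φ =>
    -a * log (u - A * f φ) + b * (-(A / u) * g φ - κ * (f φ * g φ))
  let W' : ℝ → ℝ := fun φ =>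
    a * (A * g φ / (u - A * f φ)) + b * (A / u * f φ - κ * (g φ * g φ - f φ * f φ))
  have hW : ∀ φ, HasDerivAt W (W' φ) φ := fun φ => by
    have h1 := ((((hf φ).const_mul A).const_sub u).log (hpos φ).ne').const_mul (-a)
    have h2 := (((hg φ).const_mul (-(A / u))).sub
      (((hf φ).mul (hg φ)).const_mul κ)).const_mul b
    refine (h1.add h2).congr_deriv ?_
    simp only [W']; ring
  have hfp : ∀ φ, f (φ + 2 * π) = f φ := fun φ => by simp [f]
  have hgp : ∀ φ, g (φ + 2 * π) = g φ := fun φ => by simp [g]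
  have hcW : Continuous W := continuous_iff_continuousAt.2 fun φ => (hW φ).continuousAt
  have hcW' : Continuous W' := by
    have : ∀ φ, u - A * f φ ≠ 0 := fun φ => (hpos φ).ne'
    fun_prop (disch := assumption)
  obtain ⟨w, hw⟩ := exists_abs_le_of_continuous_of_periodic hcW two_pi_pos
    (fun φ => by simp only [W, hfp, hgp])
  obtain ⟨C, hC⟩ := exists_abs_le_of_continuous_of_periodic hcW' two_pi_pos
    (fun φ => by simp only [W', hfp, hgp])
  refine ⟨W, W', w, C, b * (κ * R * (u - 3 * A)),
    mul_pos hb (mul_pos (mul_pos hκ hR) (by linarith)), (abs_nonneg _).trans (hC 0),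
    hW, hw, hC, fun φ => ?_⟩
  have hb1 := (speed_bounds hA u α φ).1
  have hb2 := (speed_bounds hA u α φ).2
  rw [hfd] at *
  have hne := (hpos φ).ne'
  have key : -A * cos (φ - α) + W' φ * (u - A * f φ) =
      b * (-(A ^ 2 / u) * f φ ^ 2 - κ * (R - 2 * f φ ^ 2) * (u - A * f φ)) := by
    rw [hcos, ← hfg φ]
    simp only [W']
    field_simp
    ring
  rw [key, ← mul_neg]
  refine mul_le_mul_of_nonneg_left ?_ hb.le
  rw [← hκ']
  have h1 : κ * R * (u - 3 * A) ≤ κ * R * (u - A * f φ) :=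
    mul_le_mul_of_nonneg_left hb1 (by positivity)
  have h2 : 2 * κ * f φ ^ 2 * (u - A * f φ) ≤ 2 * κ * f φ ^ 2 * (u + 3 * A) :=
    mul_le_mul_of_nonneg_left hb2 (by positivity)
  linarith

/-! ### Nonlinear transversal decay -/

/-- The derivative of `1 - cos e` along the flow, split into the contraction rate and an error. -/
theorem transversal_rate (A α φ e : ℝ) :
    sin e * (A * sin (φ - α) - A * sin (φ + e - α)) =
      (1 - cos e) * (-2 * A * cos (φ - α) +
        A * (sin e * sin (φ - α) + (1 - cos e) * cos (φ - α))) := by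
  have h : φ + e - α = (φ - α) + e := by ring
  rw [h, sin_add]
  linear_combination (-A * cos (φ - α)) * sin_sq_add_cos_sq e

/-- The speed of `φ` away from the synchronization manifold, split into the synchronized speed
and an error. -/
theorem speed_eq (A u α φ e : ℝ) :
    u + (A * sin (-φ - α) + A * sin (-φ - e - α)) - A * sin (φ - α) =
      u - A * drift α φ + A * (sin (φ + α) * (1 - cos e) - cos (φ + α) * sin e) := by
  have h1 : -φ - α = -(φ + α) := by ring
  have h2 : -φ - e - α = -((φ + α) + e) := by ring
  rw [h1, h2, sin_neg, sin_neg, sin_add _ e, drift]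
  ring

theorem abs_mul_add_mul_le {p q x y : ℝ} (hp : |p| ≤ 1) (hq : |q| ≤ 1) (hy : 0 ≤ y) :
    |x * p + y * q| ≤ y + |x| := by
  calc |x * p + y * q| ≤ |x * p| + |y * q| := abs_add_le _ _
    _ = |x| * |p| + y * |q| := by rw [abs_mul, abs_mul, abs_of_nonneg hy]
    _ ≤ |x| * 1 + y * 1 := by gcongr
    _ = y + |x| := by ring

/-- Uses `sin² e ≤ 2 (1 - cos e)`. -/
theorem one_sub_cos_add_abs_sin_le {e η : ℝ} (hη : 0 < η) (h1 : 1 - cos e ≤ η / 2)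
    (h2 : 1 - cos e ≤ η ^ 2 / 8) : (1 - cos e) + |sin e| ≤ η := by
  have h : |sin e| ≤ η / 2 := by
    refine abs_le_of_sq_le_sq ?_ (by positivity)
    nlinarith [sin_sq_add_cos_sq e, sq_nonneg (1 - cos e)]
  linarith

/-- Exponential decay of `1 - cos e`, where `e` is the phase difference of the peripheral nodes and
`φ` that of the central node and the first peripheral node. -/
theorem exists_decay {A u α : ℝ} (hA : 0 < A) (hu : 3 * A < u) (hα : α ∈ Set.Ioo 0 (π / 2)) :
    ∃ r > (0 : ℝ), ∃ M > (0 : ℝ), ∃ lam > (0 : ℝ), ∀ φ e : ℝ → ℝ,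
      (∀ t, 0 ≤ t → HasDerivWithinAt φ (u + (A * sin (-φ t - α) + A * sin (-φ t - e t - α)) -
        A * sin (φ t - α)) (Set.Ici 0) t) →
      (∀ t, 0 ≤ t → HasDerivWithinAt e (A * sin (φ t - α) - A * sin (φ t + e t - α))
        (Set.Ici 0) t) →
      1 - cos (e 0) < r →
      ∀ t, 0 ≤ t → 1 - cos (e t) ≤ M ^ 2 * (1 - cos (e 0)) * exp (-lam * t) ^ 2 := by
  obtain ⟨W, W', w, C, μ, hμ, hC0, hW, hw, hC, hrate⟩ := exists_corrector hA hu hα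
  -- The nonlinear errors then cost at most `μ/2`, against a surplus `2μ - μ`.
  set η := μ / (2 * (A * (1 + 2 * C))) with hη'
  have hη : 0 < η := by positivity
  have hημ : A * (1 + 2 * C) * η < μ := by
    have : A * (1 + 2 * C) * η = μ / 2 := by rw [hη']; field_simp
    linarith
  set r₀ := min (η / 2) (η ^ 2 / 8)
  have hr₀ : 0 < r₀ := lt_min (by positivity) (by positivity)
  -- Each passage between `1 - cos e` and `v` costs a factor `exp(2w)`. The rate is halved since `1
  -- - cos e` is quadratic in the distance.
  refine ⟨r₀ * exp (-(4 * w)), by positivity, exp (2 * w), exp_pos _, μ / 2, by positivity, ?_⟩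
  intro φ e hφ he h0
  set E : ℝ → ℝ := fun t => exp (2 * W (φ t) + μ * t) with hE
  set v : ℝ → ℝ := fun t => (1 - cos (e t)) * E t with hv
  set φ' : ℝ → ℝ := fun t => u + (A * sin (-φ t - α) + A * sin (-φ t - e t - α)) -
        A * sin (φ t - α)
  set e' : ℝ → ℝ := fun t => A * sin (φ t - α) - A * sin (φ t + e t - α)
  set v' : ℝ → ℝ := fun t => sin (e t) * e' t * E t +
    (1 - cos (e t)) * (E t * (2 * (W' (φ t) * φ' t) + μ)) with hv'
  have hvd : ∀ t, 0 ≤ t → HasDerivWithinAt v (v' t) (Set.Ici 0) t := fun t ht => by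
    have h1 := ((he t ht).cos).const_sub 1
    have h2 := ((((hW (φ t)).comp_hasDerivWithinAt t (hφ t ht)).const_mul 2).add
      ((hasDerivWithinAt_id t (Set.Ici 0)).const_mul μ)).exp
    refine (h1.mul h2).congr_deriv ?_
    simp only [hv', hE, e', φ', Pi.add_apply, Function.comp_apply, id_eq, mul_one]
    ring
  have hEpos : ∀ t, 0 < E t := fun t => exp_pos _
  have hElow : ∀ t, 0 ≤ t → exp (-(2 * w)) ≤ E t := fun t ht => by
    refine exp_le_exp.2 ?_
    have := (abs_le.1 (hw (φ t))).1
    have : 0 ≤ μ * t := by positivity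
    linarith
  have hy : ∀ t, 0 ≤ 1 - cos (e t) := fun t => by linarith [cos_le_one (e t)]
  have hneg : ∀ t, 0 < v t → 1 - cos (e t) ≤ r₀ → v' t < 0 := by
    intro t hvt hyt
    have hypos : 0 < 1 - cos (e t) := by
      rcases (hy t).eq_or_lt with h | h
      · simp [hv, ← h] at hvt
      · exact h
    have hsmall := one_sub_cos_add_abs_sin_le hη (hyt.trans (min_le_left _ _))
      (hyt.trans (min_le_right _ _))
    have e1 := transversal_rate A α (φ t) (e t)
    have e2 := speed_eq A u α (φ t) (e t)
    have b1 := abs_mul_add_mul_le (x := sin (e t)) (abs_sin_le_one (φ t - α))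
      (abs_cos_le_one (φ t - α)) (hy t)
    have b2 := abs_mul_add_mul_le (p := -cos (φ t + α)) (x := sin (e t))
      (by rw [abs_neg]; exact abs_cos_le_one _) (abs_sin_le_one (φ t + α)) (hy t)
    set q₁ := sin (e t) * sin (φ t - α) + (1 - cos (e t)) * cos (φ t - α)
    set q₂ := sin (e t) * -cos (φ t + α) + (1 - cos (e t)) * sin (φ t + α) with hq₂
    have b3 : W' (φ t) * q₂ ≤ C * η := by
      calc W' (φ t) * q₂ ≤ |W' (φ t) * q₂| := le_abs_self _
        _ = |W' (φ t)| * |q₂| := abs_mul _ _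
        _ ≤ C * η := by
          have := hC (φ t)
          have := b2.trans hsmall
          gcongr
    have b4 : q₁ ≤ η := (le_abs_self _).trans (b1.trans hsmall)
    have heq : v' t = (1 - cos (e t)) * E t *
        (2 * (-A * cos (φ t - α) + W' (φ t) * (u - A * drift α (φ t))) + μ +
          A * (q₁ + 2 * (W' (φ t) * q₂))) := by
      simp only [hv', e', φ']
      rw [e1, e2, hq₂]
      ring
    rw [heq]
    refine mul_neg_of_pos_of_neg (mul_pos hypos (hEpos t)) ?_
    have b5 : A * (q₁ + 2 * (W' (φ t) * q₂)) ≤ A * (1 + 2 * C) * η := by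
      rw [mul_assoc]
      refine mul_le_mul_of_nonneg_left ?_ hA.le
      linarith
    linarith [hrate (φ t)]
  have hE0 : E 0 ≤ exp (2 * w) := by
    refine exp_le_exp.2 ?_
    have := (abs_le.1 (hw (φ 0))).2
    linarith
  have hv0 : v 0 < r₀ * exp (-(2 * w)) := by
    calc v 0 ≤ (1 - cos (e 0)) * exp (2 * w) := mul_le_mul_of_nonneg_left hE0 (hy 0)
      _ < r₀ * exp (-(4 * w)) * exp (2 * w) := by gcongr
      _ = r₀ * exp (-(2 * w)) := by rw [mul_assoc, ← exp_add]; ring_nf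
  have hvnn : ∀ t, 0 ≤ v t := fun t => mul_nonneg (hy t) (hEpos t).le
  have hmono : ∀ t, 0 ≤ t → v t ≤ v 0 := by
    intro t ht
    by_contra! hlt
    -- Barrier: at level `K` the bound `1 - cos e ≤ r₀` holds, so `v' < 0` and `v` cannot cross it.
    obtain ⟨K, hK0, hK⟩ := exists_between (lt_min hlt hv0)
    have hfence := image_le_of_deriv_right_lt_deriv_boundary (f := v) (f' := v') (a := 0) (b := t)
      (B := fun _ => K) (B' := fun _ => 0)
      (fun x hx => ((hvd x hx.1).continuousWithinAt).mono Set.Icc_subset_Ici_self)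
      (fun x hx => (hvd x hx.1).mono (Set.Ici_subset_Ici.2 hx.1)) hK0.le
      (fun x => hasDerivAt_const x K) (fun x hx hxK => by
        refine hneg x (hxK ▸ (hvnn 0).trans_lt hK0) ?_
        have h1 : (1 - cos (e x)) * exp (-(2 * w)) ≤ r₀ * exp (-(2 * w)) :=
          calc _ ≤ v x := mul_le_mul_of_nonneg_left (hElow x hx.1) (hy x)
            _ = K := hxK
            _ ≤ _ := (hK.trans_le (min_le_right _ _)).le
        exact le_of_mul_le_mul_right h1 (exp_pos _))
    exact absurd (hfence (Set.right_mem_Icc.2 ht)) (not_le.2 (hK.trans_le (min_le_left _ _)))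
  intro t ht
  have h1 : (1 - cos (e t)) * exp (-(2 * w) + μ * t) ≤ (1 - cos (e 0)) * exp (2 * w) :=
    calc _ ≤ v t := by
          refine mul_le_mul_of_nonneg_left (exp_le_exp.2 ?_) (hy t)
          linarith [(abs_le.1 (hw (φ t))).1]
      _ ≤ v 0 := hmono t ht
      _ ≤ _ := mul_le_mul_of_nonneg_left hE0 (hy 0)
  calc 1 - cos (e t) = (1 - cos (e t)) * exp (-(2 * w) + μ * t) * exp (2 * w - μ * t) := by
        rw [mul_assoc, ← exp_add]; simp
    _ ≤ (1 - cos (e 0)) * exp (2 * w) * exp (2 * w - μ * t) := by gcongr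
    _ = exp (2 * w) ^ 2 * (1 - cos (e 0)) * exp (-(μ / 2) * t) ^ 2 := by
        rw [sq, sq, ← exp_add, ← exp_add, mul_comm _ (1 - cos (e 0)), mul_assoc, mul_assoc,
          ← exp_add, ← exp_add]
        ring_nf

/-! ### From `1 - cos e` to the distance -/

theorem norm_angle_eq_abs_toReal (x : Real.Angle) : ‖x‖ = |x.toReal| := by
  have h : |x.toReal| ≤ |2 * π| / 2 := by
    rw [abs_of_pos two_pi_pos]
    linarith [x.abs_toReal_le_pi]
  have := (AddCircle.norm_coe_eq_abs_iff (2 * π) two_pi_pos.ne').2 h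
  rw [← this]
  exact congrArg norm x.coe_toReal.symm

theorem one_sub_cos_le_norm_sq (x : Real.Angle) : 1 - x.cos ≤ ‖x‖ ^ 2 / 2 := by
  rw [norm_angle_eq_abs_toReal, sq_abs, ← Real.Angle.cos_toReal]
  linarith [one_sub_sq_div_two_le_cos (x := x.toReal)]

theorem norm_sq_le_one_sub_cos (x : Real.Angle) : ‖x‖ ^ 2 ≤ π ^ 2 / 2 * (1 - x.cos) := by
  rw [norm_angle_eq_abs_toReal, sq_abs, ← Real.Angle.cos_toReal]
  have h := cos_le_one_sub_mul_cos_sq x.abs_toReal_le_pi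
  have h2 : 2 / π ^ 2 * x.toReal ^ 2 ≤ 1 - cos x.toReal := by linarith
  calc x.toReal ^ 2 = π ^ 2 / 2 * (2 / π ^ 2 * x.toReal ^ 2) := by field_simp
    _ ≤ _ := by gcongr

theorem infDist_syncManifold_le (θ : Phases) : Metric.infDist θ syncManifold ≤ ‖θ 1 - θ 2‖ := by
  let y : Phases := WithLp.toLp 2 ![θ 0, θ 1, θ 1]
  have hy : y ∈ syncManifold := rfl
  refine (Metric.infDist_le_dist_of_mem hy).trans_eq ?_
  rw [PiLp.dist_eq_of_L2, Fin.sum_univ_three]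
  simp [y, dist_eq_norm, norm_sub_rev]

/-- A point of the manifold has equal peripheral phases, so they cancel in the difference. -/
theorem norm_sub_le_two_mul_infDist (θ : Phases) :
    ‖θ 1 - θ 2‖ ≤ 2 * Metric.infDist θ syncManifold := by
  have hne : syncManifold.Nonempty := ⟨0, rfl⟩
  have : ‖θ 1 - θ 2‖ / 2 ≤ Metric.infDist θ syncManifold := by
    refine (Metric.le_infDist hne).2 fun {y} hy => ?_
    have hy' : y 1 = y 2 := hy
    have h1 := PiLp.norm_apply_le (θ - y) 1
    have h2 := PiLp.norm_apply_le (θ - y) 2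
    have h3 : θ 1 - θ 2 = (θ - y) 1 - (θ - y) 2 := by
      simp [hy']
    have h4 := norm_sub_le ((θ - y) 1) ((θ - y) 2)
    rw [← h3] at h4
    rw [dist_eq_norm]
    linarith
  linarith

/-- The remote synchronization manifold is exponentially stable as soon as `u > 3 A`. -/
theorem isExpStable_syncManifold (ω : ℝ) {A u α : ℝ} (hA : 0 < A) (hu : 3 * A < u)
    (hα : α ∈ Set.Ioo 0 (π / 2)) : IsExpStable (starField ω A u α) syncManifold := by
  obtain ⟨r, hr, M, hM, lam, hlam, hdecay⟩ := exists_decay hA hu hα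
  -- `√(r/2)` comes from `1 - cos e(0) ≤ 2d²`, and `π` from `‖x‖² ≤ (π²/2)(1 - cos x)`.
  refine ⟨√(r / 2), by positivity, π * M, by positivity, lam, hlam, ?_⟩
  rintro θ ⟨x, hx⟩ h0 t ht
  set φ : ℝ → ℝ := fun t => x 0 t - x 1 t
  set e : ℝ → ℝ := fun t => x 1 t - x 2 t
  have hsin : ∀ i j t, 0 ≤ t →
      Real.Angle.sin (θ t i - θ t j - (α : Real.Angle)) = sin (x i t - x j t - α) := by
    intro i j t ht
    rw [(hx i t ht).1, (hx j t ht).1, ← Real.Angle.coe_sub, ← Real.Angle.coe_sub,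
      Real.Angle.sin_coe]
  have hφ : ∀ t, 0 ≤ t → HasDerivWithinAt φ (u + (A * sin (-φ t - α) +
      A * sin (-φ t - e t - α)) - A * sin (φ t - α)) (Set.Ici 0) t := fun t ht => by
    refine ((hx 0 t ht).2.sub (hx 1 t ht).2).congr_deriv ?_
    simp only [starField, Matrix.cons_val_zero, Matrix.cons_val_one, hsin _ _ t ht, φ, e]
    ring_nf
  have he : ∀ t, 0 ≤ t → HasDerivWithinAt e (A * sin (φ t - α) - A * sin (φ t + e t - α))
      (Set.Ici 0) t := fun t ht => by
    refine ((hx 1 t ht).2.sub (hx 2 t ht).2).congr_deriv ?_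
    simp only [starField, Matrix.cons_val_one, Matrix.cons_val, hsin _ _ t ht, φ, e]
    ring_nf
  have hcos : ∀ t, 0 ≤ t → (θ t 1 - θ t 2).cos = cos (e t) := fun t ht => by
    rw [(hx 1 t ht).1, (hx 2 t ht).1, ← Real.Angle.coe_sub, Real.Angle.cos_coe]
  set d := Metric.infDist (θ 0) syncManifold
  have hd : 0 ≤ d := Metric.infDist_nonneg
  have hstart : 1 - cos (e 0) ≤ 2 * d ^ 2 := by
    rw [← hcos 0 le_rfl]
    have h1 := one_sub_cos_le_norm_sq (θ 0 1 - θ 0 2)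
    have h2 := pow_le_pow_left₀ (norm_nonneg _) (norm_sub_le_two_mul_infDist (θ 0)) 2
    rw [mul_pow] at h2
    linarith
  have hd2 : d ^ 2 < r / 2 := (Real.lt_sqrt hd).1 h0
  have hend := hdecay φ e hφ he (by linarith) t ht
  refine (infDist_syncManifold_le (θ t)).trans
    (abs_le_of_sq_le_sq' (a := ‖θ t 1 - θ t 2‖) ?_ (by positivity)).2
  calc ‖θ t 1 - θ t 2‖ ^ 2 ≤ π ^ 2 / 2 * (1 - cos (e t)) := by
        rw [← hcos t ht]
        exact norm_sq_le_one_sub_cos _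
    _ ≤ π ^ 2 / 2 * (M ^ 2 * (2 * d ^ 2) * exp (-lam * t) ^ 2) := by
        refine mul_le_mul_of_nonneg_left (hend.trans ?_) (by positivity)
        gcongr
    _ = (π * M * d * exp (-lam * t)) ^ 2 := by ring

end RemoteSync

theorem theorem5 (ω A : ℝ) (hω : 0 < ω) (hA : 0 < A) :
    ∃ ρ : ℝ, 3 * A < ρ ∧ ∀ u : ℝ, ρ < u → ∀ α : ℝ, α ∈ Set.Ioo 0 (Real.pi / 2) →
      RemoteSync.IsExpStable (RemoteSync.starField ω A u α) RemoteSync.syncManifold :=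
  -- Any number above `3A` would do.
  ⟨4 * A, by linarith, fun _ hu _ hα =>
    RemoteSync.isExpStable_syncManifold ω hA (by linarith) hα⟩
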